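/- Let $B_j$ denote the Bernoulli numbers, defined by $\frac{x}{e^x-1}=\sum_{j\ge 0}B_j\frac{x^j}{j!}$, and let $$H_N=\sum_{j=1}^{N}\frac1j,\qquad H_{N,2}=\sum_{1\le i<j\le N}\frac{1}{ij},\qquad \binom{2n}{2k,\,2l,\,2m}=\frac{(2n)!}{(2k)!\,(2l)!\,(2m)!}\quad (k+l+m=n).$$ Then for every integer $n\ge 3$, $$\sum_{\substack{k+l+m=n\\ k,l,m\ge 1}}\frac{B_{2k}B_{2l}B_{2m}}{(2k)(2l)(2m)} =\frac{3}{2n}\sum_{\substack{k+l+m=n\\ k,l,m\ge 1}}\frac{B_{2k}B_{2l}B_{2m}}{(2k)(2l)}\binom{2n}{2k,\,2l,\,2m} +\frac{3}{n}H_{2n}\sum_{k=1}^{n-1}\binom{2n}{2k}\frac{B_{2k}B_{2n-2k}}{2k} +6H_{2n,2}\frac{B_{2n}}{2n} -\Bigl(n^2-\frac32 n+\frac54\Bigr)\frac{B_{2n-2}}{2n-2}.$$ -/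

import Mathlib

/-- The ordered triples `(k, l, m)` of integers `k, l, m ≥ 1` with `k + l + m = n`. -/
def posTriples (n : ℕ) : Finset (ℕ × ℕ × ℕ) :=
  (Finset.Icc 1 n ×ˢ Finset.Icc 1 n ×ˢ Finset.Icc 1 n).filter
    (fun t => t.1 + t.2.1 + t.2.2 = n)

/-- The second-order harmonic number, the sum of `1 / (i * j)` over `1 ≤ i < j ≤ N`. -/
def harmonicTwo (N : ℕ) : ℚ :=
  ∑ p ∈ (Finset.Icc 1 N ×ˢ Finset.Icc 1 N).filter (fun p => p.1 < p.2),
    1 / ((p.1 : ℚ) * (p.2 : ℚ))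

/-! ### Euler operator and formal exponentials with polynomial coefficients. -/

open PowerSeries

/-! The Stirling number S(n+k, k) is the n-th coefficient of ∏_{j≤k} 1/(1 - jX), and also
(k+1)⋯(k+n) times the n-th coefficient of ((e^X - 1)/X)^k
(`eval_risingPoly_mul_coeff_expQuotient_pow`). The two series are exp(∑ p_n(k) X^n/n), with p_n(k) =
1^n + ⋯ + k^n given by Faulhaber, and exp(k L), with L = log((e^X - 1)/X) = ∑ B_n X^n/(n·n!), n ≥ 1
and B_1 = 1/2. Their coefficients are polynomials in k, so the equality is one of polynomials
(`risingPoly_mul_expCoeff`).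

The theorem is its k^3 coefficient (`factorial_mul_coeff_logExpQuotient`). On one side n!, n!·H_n
and n!·H_{n,2} multiply L^3/6, L^2/2 and L; on the other stand the cube of ∑ B_n X^n/n and
corrections from the higher coefficients of p_n. At index 2n, separating the B_1 term from the even
part (`factorial_mul_coeff_evenLogSeries`) yields the B_{2n-2} term. The sums of the theorem are
coefficients of powers of the even series.

Exponentials are handled through θC = P·C, where θ = X d/dX, so no composition of series is needed.
-/

/-- The Euler operator `X * d/dX` on rational power series. -/
noncomputable def eulerOp : Derivation ℚ ℚ⟦X⟧ ℚ⟦X⟧ := (X : ℚ⟦X⟧) • derivative ℚ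

lemma eulerOp_apply (f : ℚ⟦X⟧) : eulerOp f = X * derivative ℚ f := rfl

lemma coeff_eulerOp (f : ℚ⟦X⟧) (n : ℕ) : coeff n (eulerOp f) = n * coeff n f := by
  rw [eulerOp_apply]
  cases n with
  | zero => simp
  | succ n => rw [coeff_succ_X_mul, coeff_derivative]; push_cast; ring

lemma eulerOp_mul (f g : ℚ⟦X⟧) : eulerOp (f * g) = f * eulerOp g + g * eulerOp f := by
  simp [Derivation.leibniz]

lemma eulerOp_ext {f g : ℚ⟦X⟧} (h : eulerOp f = eulerOp g) (h0 : coeff 0 f = coeff 0 g) :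
    f = g := by
  ext n
  rcases Nat.eq_zero_or_pos n with rfl | hn
  · exact h0
  · have := congrArg (coeff n) h
    rw [coeff_eulerOp, coeff_eulerOp] at this
    exact mul_left_cancel₀ (by positivity) this

/-- Since P has no constant term, the equation expresses n·u_n through earlier coefficients only. -/
lemma eq_of_eulerOp_eq_mul {P U V : ℚ⟦X⟧} (hP : coeff 0 P = 0) (hU : eulerOp U = P * U)
    (hV : eulerOp V = P * V) (h0 : coeff 0 U = coeff 0 V) : U = V := by
  ext n
  induction n using Nat.strong_induction_on with
  | _ n ih =>
    rcases Nat.eq_zero_or_pos n with rfl | hn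
    · exact h0
    · have h : coeff n (P * U) = coeff n (P * V) := by
        rw [coeff_mul, coeff_mul]
        refine Finset.sum_congr rfl fun a ha => ?_
        rw [Finset.HasAntidiagonal.mem_antidiagonal] at ha
        rcases Nat.eq_zero_or_pos a.1 with h1 | h1
        · rw [h1, hP, zero_mul, zero_mul]
        · rw [ih a.2 (by omega)]
      rw [← hU, ← hV, coeff_eulerOp, coeff_eulerOp] at h
      exact mul_left_cancel₀ (by positivity) h

/-- The coefficients `c n` of the series `C` with constant term `1` solving `X * C' = P * C`,
where `P` has coefficients `p n` and no constant term. -/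
noncomputable def expCoeff (p : ℕ → Polynomial ℚ) : ℕ → Polynomial ℚ
  | 0 => 1
  | n + 1 => Polynomial.C (1 / ((n : ℚ) + 1)) * ∑ j : Fin (n + 1), p (n + 1 - j) * expCoeff p j

lemma expCoeff_zero (p : ℕ → Polynomial ℚ) : expCoeff p 0 = 1 := by rw [expCoeff]

lemma mul_expCoeff {p : ℕ → Polynomial ℚ} (hp : p 0 = 0) (n : ℕ) :
    Polynomial.C (n : ℚ) * expCoeff p n =
      ∑ a ∈ Finset.HasAntidiagonal.antidiagonal n, p a.1 * expCoeff p a.2 := by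
  cases n with
  | zero => simp [hp]
  | succ n =>
    rw [expCoeff, ← mul_assoc, ← Polynomial.C_mul]
    have h : ((n + 1 : ℕ) : ℚ) * (1 / ((n : ℚ) + 1)) = 1 := by
      push_cast; field_simp
    rw [h, Polynomial.C_1, one_mul, Fin.sum_univ_eq_sum_range
      (fun j => p (n + 1 - j) * expCoeff p j) (n + 1), Finset.Nat.antidiagonal_succ,
      Finset.sum_cons, hp, zero_mul, zero_add, Finset.sum_map,
      ← Finset.Nat.sum_antidiagonal_swap,
      Finset.Nat.sum_antidiagonal_eq_sum_range_succ_mk]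
    refine Finset.sum_congr rfl fun j hj => ?_
    have hj' := Finset.mem_range.1 hj
    simp [Nat.succ_sub (Nat.lt_succ_iff.1 hj')]

lemma eulerOp_mk_eval_expCoeff {p : ℕ → Polynomial ℚ} (hp : p 0 = 0) (x : ℚ) :
    eulerOp (mk fun n => (expCoeff p n).eval x) =
      (mk fun n => (p n).eval x) * mk fun n => (expCoeff p n).eval x := by
  ext n
  rw [coeff_eulerOp, coeff_mul]
  simpa [Polynomial.eval_finsetSum] using congrArg (Polynomial.eval x) (mul_expCoeff hp n)

lemma eulerOp_mk_coeff_expCoeff {p : ℕ → Polynomial ℚ} (hp : p 0 = 0) (i : ℕ) :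
    eulerOp (mk fun n => (expCoeff p n).coeff i) =
      ∑ a ∈ Finset.HasAntidiagonal.antidiagonal i,
        (mk fun n => (p n).coeff a.1) * mk fun n => (expCoeff p n).coeff a.2 := by
  ext n
  have h := congrArg (fun q => Polynomial.coeff q i) (mul_expCoeff hp n)
  simp only [Polynomial.coeff_C_mul] at h
  simp only [Polynomial.finsetSum_coeff, Polynomial.coeff_mul] at h
  rw [coeff_eulerOp, coeff_mk, h, map_sum, Finset.sum_comm]
  simp only [coeff_mul, coeff_mk]

/-! ### Expansion of exp(k L₁ + k² L₂ + k³ L₃ + ⋯) up to k³. -/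

section lowCoefficients

variable {p : ℕ → Polynomial ℚ} {L₁ L₂ L₃ : ℚ⟦X⟧}

lemma mk_coeff_zero_expCoeff (hp : p 0 = 0) (h₀ : ∀ n, (p n).coeff 0 = 0) :
    (mk fun n => (expCoeff p n).coeff 0) = 1 := by
  refine eulerOp_ext ?_ (by simp [expCoeff_zero])
  rw [eulerOp_mk_coeff_expCoeff hp]
  ext n
  simp [h₀, coeff_mul]

lemma mk_coeff_one_expCoeff (hp : p 0 = 0) (h₀ : ∀ n, (p n).coeff 0 = 0)
    (h₁ : eulerOp L₁ = mk fun n => (p n).coeff 1) (z₁ : coeff 0 L₁ = 0) :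
    (mk fun n => (expCoeff p n).coeff 1) = L₁ := by
  refine eulerOp_ext ?_ (by simp [expCoeff_zero, z₁, Polynomial.coeff_one, -coeff_zero_eq_constantCoeff])
  have hz : (mk fun n => (p n).coeff 0) = 0 := by ext n; simp [h₀]
  rw [eulerOp_mk_coeff_expCoeff hp, h₁]
  simp only [Finset.Nat.sum_antidiagonal_eq_sum_range_succ_mk, Finset.sum_range_succ,
    Finset.sum_range_zero, Nat.sub_zero, Nat.sub_self, zero_add, hz, zero_mul,
    mk_coeff_zero_expCoeff hp h₀, mul_one]

lemma mk_coeff_two_expCoeff (hp : p 0 = 0) (h₀ : ∀ n, (p n).coeff 0 = 0)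
    (h₁ : eulerOp L₁ = mk fun n => (p n).coeff 1) (z₁ : coeff 0 L₁ = 0)
    (h₂ : eulerOp L₂ = mk fun n => (p n).coeff 2) (z₂ : coeff 0 L₂ = 0) :
    2 * (mk fun n => (expCoeff p n).coeff 2) = 2 * L₂ + L₁ ^ 2 := by
  have hz : (mk fun n => (p n).coeff 0) = 0 := by ext n; simp [h₀]
  have e2 : eulerOp 2 = 0 := eulerOp.map_natCast 2
  refine eulerOp_ext ?_ ?_
  · have h := eulerOp_mk_coeff_expCoeff hp 2
    simp only [Finset.Nat.sum_antidiagonal_eq_sum_range_succ_mk, Finset.sum_range_succ,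
      Finset.sum_range_zero, Nat.sub_zero, Nat.reduceSub, zero_add, hz,
      mk_coeff_zero_expCoeff hp h₀, mk_coeff_one_expCoeff hp h₀ h₁ z₁] at h
    rw [pow_two, map_add, eulerOp_mul, eulerOp_mul, eulerOp_mul, e2, h, h₁, h₂]
    ring
  · simp only [coeff_zero_eq_constantCoeff, map_mul, map_add, map_pow] at z₁ z₂ ⊢
    rw [z₁, z₂, ← coeff_zero_eq_constantCoeff_apply (mk _), coeff_mk, expCoeff_zero]
    simp [Polynomial.coeff_one]

lemma mk_coeff_three_expCoeff (hp : p 0 = 0) (h₀ : ∀ n, (p n).coeff 0 = 0)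
    (h₁ : eulerOp L₁ = mk fun n => (p n).coeff 1) (z₁ : coeff 0 L₁ = 0)
    (h₂ : eulerOp L₂ = mk fun n => (p n).coeff 2) (z₂ : coeff 0 L₂ = 0)
    (h₃ : eulerOp L₃ = mk fun n => (p n).coeff 3) (z₃ : coeff 0 L₃ = 0) :
    6 * (mk fun n => (expCoeff p n).coeff 3) = 6 * L₃ + 6 * (L₁ * L₂) + L₁ ^ 3 := by
  have hz : (mk fun n => (p n).coeff 0) = 0 := by ext n; simp [h₀]
  have e6 : eulerOp 6 = 0 := eulerOp.map_natCast 6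
  refine eulerOp_ext ?_ ?_
  · have h := eulerOp_mk_coeff_expCoeff hp 3
    have h2 := mk_coeff_two_expCoeff hp h₀ h₁ z₁ h₂ z₂
    simp only [Finset.Nat.sum_antidiagonal_eq_sum_range_succ_mk, Finset.sum_range_succ,
      Finset.sum_range_zero, Nat.sub_zero, Nat.reduceSub, zero_add, hz,
      mk_coeff_zero_expCoeff hp h₀, mk_coeff_one_expCoeff hp h₀ h₁ z₁] at h
    have e : L₁ ^ 3 = L₁ * (L₁ * L₁) := by ring
    rw [e, map_add, map_add, eulerOp_mul, eulerOp_mul, eulerOp_mul, eulerOp_mul, eulerOp_mul,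
      eulerOp_mul, e6, h, h₁, h₂, h₃]
    linear_combination 3 * (mk fun n => (p n).coeff 1) * h2
  · simp only [coeff_zero_eq_constantCoeff, map_mul, map_add, map_pow] at z₁ z₂ z₃ ⊢
    rw [z₁, z₂, z₃, ← coeff_zero_eq_constantCoeff_apply (mk _), coeff_mk, expCoeff_zero]
    simp [Polynomial.coeff_one]

end lowCoefficients

/-! ### Powers of (e^X - 1)/X. -/

section exponentialSide

/-- The series `(exp X - 1) / X`. -/
noncomputable def expQuotient : ℚ⟦X⟧ := mk fun n => 1 / ((n + 1).factorial : ℚ)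

lemma X_mul_expQuotient : X * expQuotient = exp ℚ - 1 := by
  ext n
  cases n with
  | zero => simp
  | succ n => simp [coeff_succ_X_mul, expQuotient, coeff_exp, coeff_one]

lemma eulerOp_expQuotient_add : eulerOp expQuotient + expQuotient = exp ℚ := by
  have h := congrArg eulerOp X_mul_expQuotient
  rw [eulerOp_mul, map_sub, eulerOp_apply X, eulerOp_apply (exp ℚ), derivative_exp,
    Derivation.map_one_eq_zero, derivative_X] at h
  refine mul_left_cancel₀ (X_ne_zero (R := ℚ)) ?_
  linear_combination h

/-- `bernoulli'PowerSeries` is X e^X/(e^X - 1), which is 1 + θ log((e^X - 1)/X). -/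
lemma eulerOp_expQuotient :
    eulerOp expQuotient = (bernoulli'PowerSeries ℚ - 1) * expQuotient := by
  have h := bernoulli'PowerSeries_mul_exp_sub_one ℚ
  rw [← X_mul_expQuotient, ← eulerOp_expQuotient_add] at h
  refine mul_left_cancel₀ (X_ne_zero (R := ℚ)) ?_
  linear_combination -h

lemma eulerOp_expQuotient_pow (k : ℕ) :
    eulerOp (expQuotient ^ k) =
      ((k : ℚ⟦X⟧) * (bernoulli'PowerSeries ℚ - 1)) * expQuotient ^ k := by
  induction k with
  | zero => simp
  | succ k ih =>
    rw [pow_succ, eulerOp_mul, ih, eulerOp_expQuotient]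
    push_cast
    ring

/-- Comes from θQ + Q = XQ + 1 multiplied by (k+1) Q^k. Once scaled by the rising product it becomes
the Stirling recurrence of `coeff_succ_geomProd_succ`. -/
lemma coeff_expQuotient_pow_succ (k n : ℕ) :
    ((n : ℚ) + k + 2) * coeff (n + 1) (expQuotient ^ (k + 1)) =
      (k + 1) * coeff n (expQuotient ^ (k + 1)) + (k + 1) * coeff (n + 1) (expQuotient ^ k) := by
  have h : eulerOp (expQuotient ^ (k + 1)) + C ((k : ℚ) + 1) * expQuotient ^ (k + 1) =
      C ((k : ℚ) + 1) * (X * expQuotient ^ (k + 1)) + C ((k : ℚ) + 1) * expQuotient ^ k := by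
    have h1 : eulerOp expQuotient + expQuotient = X * expQuotient + 1 := by
      rw [eulerOp_expQuotient_add, X_mul_expQuotient]; ring
    rw [eulerOp_expQuotient] at h1
    rw [eulerOp_expQuotient_pow]
    simp only [map_add, map_one, map_natCast]
    push_cast
    linear_combination ((k : ℚ⟦X⟧) + 1) * expQuotient ^ k * h1
  have h' := congrArg (coeff (n + 1)) h
  simp only [map_add (coeff (n + 1)), coeff_eulerOp, coeff_C_mul, coeff_succ_X_mul] at h'
  push_cast at h'
  linear_combination h'

/-- The polynomials whose values at `k` are the coefficients of `X * d/dX log (expQuotient ^ k)`. -/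
noncomputable def expLogDeriv (n : ℕ) : Polynomial ℚ :=
  Polynomial.C (coeff n (bernoulli'PowerSeries ℚ - 1)) * Polynomial.X

lemma coeff_zero_bernoulli'PowerSeries_sub_one :
    coeff 0 (bernoulli'PowerSeries ℚ - 1) = 0 := by
  simp [bernoulli'PowerSeries]

lemma eval_expCoeff_expLogDeriv (k n : ℕ) :
    (expCoeff expLogDeriv n).eval (k : ℚ) = coeff n (expQuotient ^ k) := by
  have hp : expLogDeriv 0 = 0 := by
    rw [expLogDeriv, coeff_zero_bernoulli'PowerSeries_sub_one, map_zero, zero_mul]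
  have hmk : (mk fun n => (expLogDeriv n).eval (k : ℚ)) =
      (k : ℚ⟦X⟧) * (bernoulli'PowerSeries ℚ - 1) := by
    rw [← map_natCast (C (R := ℚ)) k]
    ext n
    rw [coeff_C_mul, coeff_mk, expLogDeriv, Polynomial.eval_mul, Polynomial.eval_C,
      Polynomial.eval_X, mul_comm]
  have h := eulerOp_mk_eval_expCoeff hp (k : ℚ)
  rw [hmk] at h
  have := eq_of_eulerOp_eq_mul ?_ h (eulerOp_expQuotient_pow k) ?_
  · rw [← this, coeff_mk]
  · rw [← map_natCast (C (R := ℚ)) k, coeff_C_mul, coeff_zero_bernoulli'PowerSeries_sub_one,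
      mul_zero]
  · simp [expCoeff_zero, expQuotient, ← coeff_zero_eq_constantCoeff_apply (mk _)]

end exponentialSide

/-! ### The product of geometric series and its power sums. -/

section geometricSide

/-- The geometric series `1 / (1 - a X)`. -/
noncomputable def geomSeries (a : ℚ) : ℚ⟦X⟧ := mk fun n => a ^ n

lemma geomSeries_eq (a : ℚ) : geomSeries a = C a * (X * geomSeries a) + 1 := by
  ext n
  cases n with
  | zero => simp [geomSeries]
  | succ n =>
    rw [map_add, coeff_C_mul, coeff_succ_X_mul]
    simp [geomSeries, coeff_one, pow_succ, mul_comm]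

lemma eulerOp_geomSeries (a : ℚ) : eulerOp (geomSeries a) = (geomSeries a - 1) * geomSeries a := by
  have h := geomSeries_eq a
  have h' := congrArg eulerOp h
  rw [map_add, eulerOp_mul, eulerOp_mul, eulerOp_apply X, eulerOp_apply (C a), derivative_C,
    Derivation.map_one_eq_zero, derivative_X] at h'
  have hc : (1 - C a * X) ≠ (0 : ℚ⟦X⟧) := by
    intro h0
    have := congrArg (coeff 0) h0
    simp at this
  refine mul_left_cancel₀ hc ?_
  linear_combination h' - geomSeries a * h

/-- The product `∏_{j=1}^k 1 / (1 - j X)`. -/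
noncomputable def geomProd (k : ℕ) : ℚ⟦X⟧ := ∏ j ∈ Finset.range k, geomSeries ((j : ℚ) + 1)

lemma geomProd_succ (k : ℕ) : geomProd (k + 1) = geomProd k * geomSeries ((k : ℚ) + 1) :=
  Finset.prod_range_succ _ _

lemma coeff_zero_geomProd (k : ℕ) : coeff 0 (geomProd k) = 1 := by
  simp [geomProd, geomSeries, ← coeff_zero_eq_constantCoeff_apply (mk _)]

lemma coeff_succ_geomProd_succ (k n : ℕ) :
    coeff (n + 1) (geomProd (k + 1)) =
      (k + 1) * coeff n (geomProd (k + 1)) + coeff (n + 1) (geomProd k) := by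
  have h : geomProd (k + 1) = C ((k : ℚ) + 1) * (X * geomProd (k + 1)) + geomProd k := by
    rw [geomProd_succ]
    linear_combination geomProd k * geomSeries_eq ((k : ℚ) + 1)
  conv_lhs => rw [h, map_add, coeff_C_mul, coeff_succ_X_mul]

lemma eulerOp_geomProd (k : ℕ) :
    eulerOp (geomProd k) =
      (∑ j ∈ Finset.range k, (geomSeries ((j : ℚ) + 1) - 1)) * geomProd k := by
  induction k with
  | zero => simp [geomProd]
  | succ k ih =>
    rw [geomProd_succ, eulerOp_mul, ih, eulerOp_geomSeries, Finset.sum_range_succ]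
    ring

/-- The polynomials whose values at `k` are the coefficients of `X * d/dX log (geomProd k)`,
that is, the power sums `1 ^ n + ... + k ^ n` for `n ≥ 1`. -/
noncomputable def powerSumPoly (n : ℕ) : Polynomial ℚ :=
  if n = 0 then 0 else ∑ i ∈ Finset.range (n + 1),
    Polynomial.C (bernoulli' i * (n + 1).choose i / (n + 1)) * Polynomial.X ^ (n + 1 - i)

lemma eval_powerSumPoly (k n : ℕ) :
    (powerSumPoly n).eval (k : ℚ) =
      coeff n (∑ j ∈ Finset.range k, (geomSeries ((j : ℚ) + 1) - 1)) := by
  rcases Nat.eq_zero_or_pos n with rfl | hn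
  -- Index 0 is set to 0 in `powerSumPoly` to match the constant term removed by the `- 1`.
  · simp [powerSumPoly, geomSeries, ← coeff_zero_eq_constantCoeff_apply (mk _)]
  · have h := sum_Ico_pow k n
    rw [Finset.sum_Ico_eq_sum_range] at h
    simp only [powerSumPoly, hn.ne', if_false, Polynomial.eval_finsetSum, Polynomial.eval_mul,
      Polynomial.eval_C, Polynomial.eval_pow, Polynomial.eval_X, map_sum, map_sub, coeff_one,
      geomSeries, coeff_mk, sub_zero]
    refine Eq.trans (Finset.sum_congr rfl fun i _ => ?_) (h.symm.trans ?_)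
    · ring
    · simp [add_comm]

lemma eval_expCoeff_powerSumPoly (k n : ℕ) :
    (expCoeff powerSumPoly n).eval (k : ℚ) = coeff n (geomProd k) := by
  have hp : powerSumPoly 0 = 0 := by simp [powerSumPoly]
  have hmk : (mk fun n => (powerSumPoly n).eval (k : ℚ)) =
      ∑ j ∈ Finset.range k, (geomSeries ((j : ℚ) + 1) - 1) := by
    ext n
    rw [coeff_mk, eval_powerSumPoly]
  have h := eulerOp_mk_eval_expCoeff hp (k : ℚ)
  rw [hmk] at h
  have := eq_of_eulerOp_eq_mul ?_ h (eulerOp_geomProd k) ?_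
  · rw [← this, coeff_mk]
  · rw [← eval_powerSumPoly, hp, Polynomial.eval_zero]
  · rw [coeff_zero_geomProd, coeff_mk, expCoeff_zero, Polynomial.eval_one]

end geometricSide

/-! ### The Stirling number identity, as polynomials in k. -/

section stirling

/-- The polynomial `(X + 1) (X + 2) ⋯ (X + n)`. -/
noncomputable def risingPoly (n : ℕ) : Polynomial ℚ :=
  ∏ i ∈ Finset.range n, (Polynomial.X + Polynomial.C ((i : ℚ) + 1))

lemma risingPoly_succ (n : ℕ) :
    risingPoly (n + 1) = risingPoly n * (Polynomial.X + Polynomial.C ((n : ℚ) + 1)) :=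
  Finset.prod_range_succ _ _

lemma eval_risingPoly_succ (n : ℕ) (x : ℚ) :
    (risingPoly (n + 1)).eval x = (x + 1) * (risingPoly n).eval (x + 1) := by
  simp only [risingPoly, Polynomial.eval_prod, Polynomial.eval_add, Polynomial.eval_X,
    Polynomial.eval_C]
  rw [Finset.prod_range_succ', mul_comm, Nat.cast_zero, zero_add]
  congr 1
  exact Finset.prod_congr rfl fun i _ => by push_cast; ring

lemma eval_risingPoly_mul_coeff_expQuotient_pow (k n : ℕ) :
    (risingPoly n).eval (k : ℚ) * coeff n (expQuotient ^ k) = coeff n (geomProd k) := by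
  induction k generalizing n with
  | zero => cases n <;> simp [geomProd, risingPoly, coeff_one]
  | succ k ihk =>
    induction n with
    | zero =>
      rw [coeff_zero_geomProd]
      simp [risingPoly, expQuotient, ← coeff_zero_eq_constantCoeff_apply (mk _)]
    | succ n ihn =>
      have h1 := eval_risingPoly_succ n (k : ℚ)
      have h2 : (risingPoly (n + 1)).eval ((k + 1 : ℕ) : ℚ) =
          (risingPoly n).eval ((k + 1 : ℕ) : ℚ) * ((n : ℚ) + k + 2) := by
        rw [risingPoly_succ]
        simp only [Polynomial.eval_mul, Polynomial.eval_add, Polynomial.eval_X, Polynomial.eval_C]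
        push_cast
        ring
      rw [coeff_succ_geomProd_succ, ← ihn, ← ihk, h1, h2, mul_assoc, coeff_expQuotient_pow_succ]
      push_cast
      ring

lemma risingPoly_mul_expCoeff (n : ℕ) :
    risingPoly n * expCoeff expLogDeriv n = expCoeff powerSumPoly n := by
  refine Polynomial.eq_of_infinite_eval_eq _ _
    ((Set.infinite_range_of_injective (Nat.cast_injective (R := ℚ))).mono ?_)
  rintro _ ⟨k, rfl⟩
  simp only [Set.mem_ofPred_eq, Polynomial.eval_mul]
  rw [eval_expCoeff_expLogDeriv, eval_expCoeff_powerSumPoly,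
    eval_risingPoly_mul_coeff_expQuotient_pow]

lemma harmonicTwo_succ (n : ℕ) :
    harmonicTwo (n + 1) = harmonicTwo n + harmonic n / ((n : ℚ) + 1) := by
  have key : ∀ m, harmonicTwo m =
      ∑ j ∈ Finset.range m, ∑ i ∈ Finset.range j, 1 / (((i : ℚ) + 1) * ((j : ℚ) + 1)) := by
    intro m
    rw [harmonicTwo, Finset.sum_sigma']
    -- The larger index becomes the outer one, and both are shifted to start at 0.
    refine Finset.sum_bij' (fun p _ => ⟨p.2 - 1, p.1 - 1⟩) (fun p _ => (p.2 + 1, p.1 + 1))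
      ?_ ?_ ?_ ?_ ?_
    · intro p hp
      simp only [Finset.mem_filter, Finset.mem_product, Finset.mem_Icc, Finset.mem_sigma,
        Finset.mem_range] at hp ⊢
      omega
    · intro p hp
      simp only [Finset.mem_filter, Finset.mem_product, Finset.mem_Icc, Finset.mem_sigma,
        Finset.mem_range] at hp ⊢
      omega
    · rintro ⟨a, b⟩ hp
      simp only [Finset.mem_filter, Finset.mem_product, Finset.mem_Icc] at hp
      simp only [Prod.mk.injEq]
      omega
    · rintro ⟨a, b⟩ hp
      simp
    · rintro ⟨a, b⟩ hp
      simp only [Finset.mem_filter, Finset.mem_product, Finset.mem_Icc] at hp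
      simp only
      rw [Nat.cast_sub (by omega), Nat.cast_sub (by omega)]
      simp
  rw [key, key, Finset.sum_range_succ, harmonic, Finset.sum_div]
  congr 1
  refine Finset.sum_congr rfl fun i _ => ?_
  push_cast
  field_simp

/-- The product is n!·∏(1 + X/i), so its coefficients are n! times elementary symmetric functions of
1, 1/2, …, 1/n. -/
lemma coeff_risingPoly (n : ℕ) :
    (risingPoly n).coeff 0 = n.factorial ∧
    (risingPoly n).coeff 1 = n.factorial * harmonic n ∧
    (risingPoly n).coeff 2 = n.factorial * harmonicTwo n := by
  induction n with
  | zero => simp [risingPoly, Polynomial.coeff_one, harmonicTwo]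
  | succ n ih =>
    obtain ⟨h0, h1, h2⟩ := ih
    rw [risingPoly_succ, mul_add, Nat.factorial_succ, harmonic_succ, harmonicTwo_succ]
    have x1 : (risingPoly n * Polynomial.X).coeff 1 = (risingPoly n).coeff 0 :=
      Polynomial.coeff_mul_X _ 0
    have x2 : (risingPoly n * Polynomial.X).coeff 2 = (risingPoly n).coeff 1 :=
      Polynomial.coeff_mul_X _ 1
    simp only [Polynomial.coeff_add, Polynomial.coeff_mul_C, Polynomial.coeff_mul_X_zero,
      x1, x2, h0, h1, h2]
    push_cast
    refine ⟨by ring, ?_, ?_⟩ <;> field_simp <;> ring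

end stirling

/-! ### Comparison of the coefficients of k³. -/

section comparison

/-- The logarithm of `(exp X - 1) / X`. -/
noncomputable def logExpQuotient : ℚ⟦X⟧ := mk fun n => bernoulli' n / (n * n.factorial)

/-- The series of the coefficients of `k` in the power sums, divided by the exponent. -/
noncomputable def powerSumSeriesOne : ℚ⟦X⟧ := mk fun n => bernoulli' n / n

/-- The series of the coefficients of `k ^ 2` in the power sums, divided by the exponent. -/
noncomputable def powerSumSeriesTwo : ℚ⟦X⟧ :=
  mk fun n => if n = 0 then 0 else bernoulli' (n - 1) / 2

/-- The series of the coefficients of `k ^ 3` in the power sums, divided by the exponent. -/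
noncomputable def powerSumSeriesThree : ℚ⟦X⟧ :=
  mk fun n => if n < 2 then 0 else bernoulli' (n - 2) * ((n : ℚ) - 1) / 6

lemma six_mul_coeff_three_expCoeff_powerSumPoly :
    6 * (mk fun n => (expCoeff powerSumPoly n).coeff 3) =
      6 * powerSumSeriesThree + 6 * (powerSumSeriesOne * powerSumSeriesTwo) +
        powerSumSeriesOne ^ 3 := by
  -- In Faulhaber's formula k^d arises only from i = n + 1 - d.
  have hc : ∀ n d, n ≠ 0 → (powerSumPoly n).coeff d =
      if d = 0 ∨ n + 1 < d then 0
      else bernoulli' (n + 1 - d) * (n + 1).choose (n + 1 - d) / (n + 1) := by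
    intro n d hn
    simp only [powerSumPoly, hn, if_false, Polynomial.finsetSum_coeff, Polynomial.coeff_C_mul,
      Polynomial.coeff_X_pow]
    split_ifs with h
    · refine Finset.sum_eq_zero fun i hi => ?_
      rw [Finset.mem_range] at hi
      rw [if_neg (by omega), mul_zero]
    · rw [Finset.sum_eq_single_of_mem (n + 1 - d) (Finset.mem_range.2 (by omega))]
      · rw [if_pos (by omega), mul_one]
      · intro i hi hne
        rw [Finset.mem_range] at hi
        rw [if_neg (by omega), mul_zero]
  have hp : powerSumPoly 0 = 0 := by simp [powerSumPoly]
  refine mk_coeff_three_expCoeff hp ?_ ?_ ?_ ?_ ?_ ?_ ?_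
  · intro n
    rcases eq_or_ne n 0 with rfl | hn
    · simp [hp]
    · simp [hc n 0 hn]
  · ext n
    rw [coeff_eulerOp, coeff_mk, powerSumSeriesOne, coeff_mk]
    rcases eq_or_ne n 0 with rfl | hn
    · simp [hp]
    · have hn' : (n : ℚ) ≠ 0 := by exact_mod_cast hn
      rw [hc n 1 hn, if_neg (by omega), Nat.add_sub_cancel, Nat.choose_succ_self_right]
      push_cast
      field_simp
  -- Division by zero makes the constant term 0, as required.
  · simp [powerSumSeriesOne]
  · ext n
    rw [coeff_eulerOp, coeff_mk, powerSumSeriesTwo, coeff_mk]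
    rcases n with _ | n
    · simp [hp]
    · rw [hc _ 2 (by omega), if_neg (by omega), if_neg (by omega),
        Nat.choose_symm_of_eq_add (a := n + 1 + 1 - 2) (b := 2) (by omega),
        Nat.cast_choose_two, show n + 1 + 1 - 2 = n by omega, Nat.add_sub_cancel]
      push_cast
      field_simp
      ring
  · simp [powerSumSeriesTwo]
  · ext n
    rw [coeff_eulerOp, coeff_mk, powerSumSeriesThree, coeff_mk]
    rcases n with _ | _ | n
    · simp [hp]
    -- The power sum of exponent 1 is quadratic in k, whence the default 0 for n < 2.
    · rw [hc _ 3 (by omega)]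
      simp
    · rw [hc _ 3 (by omega), if_neg (by omega), if_neg (by omega),
        Nat.choose_symm_of_eq_add (a := n + 1 + 1 + 1 - 3) (b := 3) (by omega),
        show n + 1 + 1 + 1 - 3 = n by omega, show n + 1 + 1 - 2 = n by omega,
        Nat.cast_choose_eq_ascPochhammer_div]
      simp [ascPochhammer_succ_eval, Nat.factorial]
      field_simp
      ring
  · simp [powerSumSeriesThree]

/-- The exponent is linear in k, so L₂ = L₃ = 0. -/
lemma log_coefficients :
    (mk fun n => (expCoeff expLogDeriv n).coeff 0) = 1 ∧
    (mk fun n => (expCoeff expLogDeriv n).coeff 1) = logExpQuotient ∧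
    2 * (mk fun n => (expCoeff expLogDeriv n).coeff 2) = logExpQuotient ^ 2 ∧
    6 * (mk fun n => (expCoeff expLogDeriv n).coeff 3) = logExpQuotient ^ 3 := by
  have hp : expLogDeriv 0 = 0 := by
    rw [expLogDeriv, coeff_zero_bernoulli'PowerSeries_sub_one, map_zero, zero_mul]
  have h₀ : ∀ n, (expLogDeriv n).coeff 0 = 0 := fun n => by simp [expLogDeriv]
  have h₁ : eulerOp logExpQuotient = mk fun n => (expLogDeriv n).coeff 1 := by
    ext n
    rw [coeff_eulerOp, logExpQuotient, coeff_mk, coeff_mk]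
    rcases eq_or_ne n 0 with rfl | hn
    · simp [hp]
    · have hn' : (n : ℚ) ≠ 0 := by exact_mod_cast hn
      simp [expLogDeriv, bernoulli'PowerSeries, coeff_one, hn]
      field_simp
  have z₁ : coeff 0 logExpQuotient = 0 := by simp [logExpQuotient]
  have h₂ : eulerOp 0 = mk fun n => (expLogDeriv n).coeff 2 := by
    ext n
    rw [coeff_mk, expLogDeriv, Polynomial.coeff_C_mul]
    simp [Polynomial.coeff_X]
  have h₃ : eulerOp 0 = mk fun n => (expLogDeriv n).coeff 3 := by
    ext n
    rw [coeff_mk, expLogDeriv, Polynomial.coeff_C_mul]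
    simp [Polynomial.coeff_X]
  refine ⟨mk_coeff_zero_expCoeff hp h₀, mk_coeff_one_expCoeff hp h₀ h₁ z₁, ?_, ?_⟩
  · simpa using mk_coeff_two_expCoeff hp h₀ h₁ z₁ h₂ (map_zero _)
  · simpa using mk_coeff_three_expCoeff hp h₀ h₁ z₁ h₂ (map_zero _) h₃ (map_zero _)

lemma factorial_mul_coeff_logExpQuotient {n : ℕ} (hn : n ≠ 0) :
    (n.factorial : ℚ) * (coeff n (logExpQuotient ^ 3) +
        3 * harmonic n * coeff n (logExpQuotient ^ 2) +
        6 * harmonicTwo n * coeff n logExpQuotient) =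
      6 * coeff n powerSumSeriesThree + 6 * coeff n (powerSumSeriesOne * powerSumSeriesTwo) +
        coeff n (powerSumSeriesOne ^ 3) := by
  obtain ⟨l0, l1, l2, l3⟩ := log_coefficients
  obtain ⟨r0, r1, r2⟩ := coeff_risingPoly n
  have two (f : ℚ⟦X⟧) : coeff n (2 * f) = 2 * coeff n f := coeff_C_mul n f 2
  have six (f : ℚ⟦X⟧) : coeff n (6 * f) = 6 * coeff n f := coeff_C_mul n f 6
  have h := congrArg (fun q => Polynomial.coeff q 3) (risingPoly_mul_expCoeff n)
  simp only [Polynomial.coeff_mul, Finset.Nat.sum_antidiagonal_eq_sum_range_succ_mk,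
    Finset.sum_range_succ, Finset.sum_range_zero, Nat.sub_zero, Nat.reduceSub, zero_add,
    r0, r1, r2] at h
  have hs := congrArg (coeff n) six_mul_coeff_three_expCoeff_powerSumPoly
  have l0' := congrArg (coeff n) l0
  have l1' := congrArg (coeff n) l1
  have l2' := congrArg (coeff n) l2
  have l3' := congrArg (coeff n) l3
  -- This removes the k³ coefficient of the rising product, which would bring in a third-order
  -- harmonic number.
  rw [coeff_mk, coeff_one, if_neg hn] at l0'
  simp only [map_add, two, six, coeff_mk] at hs l1' l2' l3'
  rw [l0', l1'] at h
  rw [← hs, ← h, ← l2', ← l3']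
  ring

end comparison

/-! ### Restriction to even indices. -/

section evenPart

lemma coeff_two_mul_expand_add (n : ℕ) (U V : ℚ⟦X⟧) :
    coeff (2 * n) (expand 2 two_ne_zero U + X * expand 2 two_ne_zero V) = coeff n U := by
  rw [map_add, coeff_expand_mul]
  cases n with
  | zero => simp
  | succ n =>
    rw [show 2 * (n + 1) = 2 * n + 1 + 1 by ring, coeff_succ_X_mul,
      coeff_expand_of_not_dvd _ _ _ (by omega), add_zero]

lemma eq_C_mul_X_add_expand {f : ℚ⟦X⟧} (hf : ∀ n, Odd n → 1 < n → coeff n f = 0) :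
    f = C (coeff 1 f) * X + expand 2 two_ne_zero (mk fun n => coeff (2 * n) f) := by
  ext n
  rw [map_add, coeff_C_mul, coeff_X]
  rcases Nat.even_or_odd' n with ⟨m, rfl | rfl⟩
  · rw [if_neg (by omega), coeff_expand_mul, coeff_mk]; ring
  · rw [coeff_expand_of_not_dvd _ _ _ (by omega)]
    rcases Nat.eq_zero_or_pos m with rfl | hm
    · simp
    · rw [hf _ (odd_two_mul_add_one m) (by omega), if_neg (by omega)]; ring

lemma bernoulli'_two_mul (n : ℕ) : bernoulli' (2 * n) = bernoulli (2 * n) :=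
  (bernoulli_eq_bernoulli'_of_ne_one (by omega)).symm

/-- The generating series of the `bernoulli (2 * n)`. -/
noncomputable def evenBernoulliSeries : ℚ⟦X⟧ := mk fun n => bernoulli (2 * n)

/-- The generating series of the `bernoulli (2 * n) / (2 * n)`, without constant term. -/
noncomputable def evenPowerSumSeries : ℚ⟦X⟧ := mk fun n => bernoulli (2 * n) / (2 * (n : ℚ))

/-- The exponential generating series of the `bernoulli (2 * n) / (2 * n)`, in the variable
`X ^ 2` and without constant term. -/
noncomputable def evenLogSeries : ℚ⟦X⟧ :=
  mk fun n => bernoulli (2 * n) / (2 * (n : ℚ) * (2 * n).factorial)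

lemma logExpQuotient_eq :
    logExpQuotient = C (1 / 2) * X + expand 2 two_ne_zero evenLogSeries := by
  convert eq_C_mul_X_add_expand (f := logExpQuotient) ?_ using 4
  · simp [logExpQuotient]
  · ext n
    simp [logExpQuotient, evenLogSeries, bernoulli'_two_mul]
  · intro n ho hn
    rw [logExpQuotient, coeff_mk, bernoulli'_eq_zero_of_odd ho hn, zero_div]

lemma powerSumSeriesOne_eq :
    powerSumSeriesOne = C (1 / 2) * X + expand 2 two_ne_zero evenPowerSumSeries := by
  convert eq_C_mul_X_add_expand (f := powerSumSeriesOne) ?_ using 4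
  · simp [powerSumSeriesOne]
  · ext n
    simp [powerSumSeriesOne, evenPowerSumSeries, bernoulli'_two_mul]
  · intro n ho hn
    rw [powerSumSeriesOne, coeff_mk, bernoulli'_eq_zero_of_odd ho hn, zero_div]

lemma powerSumSeriesTwo_eq :
    powerSumSeriesTwo =
      C (1 / 2) * (X * (C (1 / 2) * X + expand 2 two_ne_zero evenBernoulliSeries)) := by
  have h : (mk fun n => bernoulli' n) =
      C (1 / 2) * X + expand 2 two_ne_zero evenBernoulliSeries := by
    convert eq_C_mul_X_add_expand (f := mk fun n => bernoulli' n) ?_ using 4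
    · simp
    · ext n
      simp [evenBernoulliSeries, bernoulli'_two_mul]
    · intro n ho hn
      rw [coeff_mk, bernoulli'_eq_zero_of_odd ho hn]
  rw [← h]
  ext n
  rw [coeff_C_mul]
  cases n with
  | zero => simp [powerSumSeriesTwo]
  | succ n =>
    rw [coeff_succ_X_mul, powerSumSeriesTwo, coeff_mk, coeff_mk, if_neg (by omega),
      Nat.add_sub_cancel]
    ring

/-- The cross term is odd, and a²X² reaches only index 2, which `hn` excludes. -/
lemma coeff_C_mul_X_add_expand_sq {n : ℕ} (hn : 2 ≤ n) (a : ℚ) (F : ℚ⟦X⟧) :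
    coeff (2 * n) ((C a * X + expand 2 two_ne_zero F) ^ 2) = coeff n (F ^ 2) := by
  have h : (C a * X + expand 2 two_ne_zero F) ^ 2 =
      expand 2 two_ne_zero (F ^ 2 + C (a ^ 2) * X) +
        X * expand 2 two_ne_zero (C (2 * a) * F) := by
    simp only [map_add, map_mul, map_pow, expand_C, expand_X, map_ofNat]
    ring
  rw [h, coeff_two_mul_expand_add, map_add, coeff_C_mul, coeff_X, if_neg (by omega)]
  ring

lemma coeff_C_mul_X_add_expand_cube (n : ℕ) (a : ℚ) (F : ℚ⟦X⟧) :
    coeff (2 * (n + 1)) ((C a * X + expand 2 two_ne_zero F) ^ 3) =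
      coeff (n + 1) (F ^ 3) + 3 * a ^ 2 * coeff n F := by
  have h : (C a * X + expand 2 two_ne_zero F) ^ 3 =
      expand 2 two_ne_zero (F ^ 3 + C (3 * a ^ 2) * (X * F)) +
        X * expand 2 two_ne_zero (C (3 * a) * F ^ 2 + C (a ^ 3) * X) := by
    simp only [map_add, map_mul, map_pow, expand_C, expand_X, map_ofNat]
    ring
  rw [h, coeff_two_mul_expand_add, map_add, coeff_C_mul, coeff_succ_X_mul]

lemma coeff_powerSumSeriesOne_mul_powerSumSeriesTwo (n : ℕ) :
    coeff (2 * (n + 1)) (powerSumSeriesOne * powerSumSeriesTwo) =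
      1 / 4 * coeff n evenBernoulliSeries + 1 / 4 * coeff n evenPowerSumSeries := by
  have h : powerSumSeriesOne * powerSumSeriesTwo =
      expand 2 two_ne_zero
        (C (1 / 4) * (X * evenBernoulliSeries) + C (1 / 4) * (X * evenPowerSumSeries)) +
      X * expand 2 two_ne_zero
        (C (1 / 8) * X + C (1 / 2) * (evenPowerSumSeries * evenBernoulliSeries)) := by
    have h4 : (C (1 / 4) : ℚ⟦X⟧) = C (1 / 2) ^ 2 := by rw [← map_pow]; norm_num
    have h8 : (C (1 / 8) : ℚ⟦X⟧) = C (1 / 2) ^ 3 := by rw [← map_pow]; norm_num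
    rw [powerSumSeriesOne_eq, powerSumSeriesTwo_eq]
    simp only [map_add, map_mul, expand_C, expand_X]
    rw [h4, h8]
    ring
  rw [h, coeff_two_mul_expand_add, map_add, coeff_C_mul, coeff_C_mul, coeff_succ_X_mul,
    coeff_succ_X_mul]

/-- The comparison of the coefficients of `k ^ 3`, in terms of the even-indexed series. -/
lemma factorial_mul_coeff_evenLogSeries {n : ℕ} (hn : 1 ≤ n) :
    ((2 * (n + 1)).factorial : ℚ) * (coeff (n + 1) (evenLogSeries ^ 3) +
        3 / 4 * coeff n evenLogSeries +
        3 * harmonic (2 * (n + 1)) * coeff (n + 1) (evenLogSeries ^ 2) +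
        6 * harmonicTwo (2 * (n + 1)) * coeff (n + 1) evenLogSeries) =
      bernoulli (2 * n) * (2 * n + 1) + 3 / 2 * bernoulli (2 * n) +
        9 / 4 * coeff n evenPowerSumSeries + coeff (n + 1) (evenPowerSumSeries ^ 3) := by
  have h := factorial_mul_coeff_logExpQuotient (n := 2 * (n + 1)) (by omega)
  have h3 : coeff (2 * (n + 1)) powerSumSeriesThree = bernoulli (2 * n) * (2 * n + 1) / 6 := by
    rw [powerSumSeriesThree, coeff_mk, if_neg (by omega), show 2 * (n + 1) - 2 = 2 * n by omega,
      bernoulli'_two_mul]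
    push_cast
    ring
  have h1 : coeff (2 * (n + 1)) logExpQuotient = coeff (n + 1) evenLogSeries := by
    rw [logExpQuotient_eq, map_add, coeff_C_mul, coeff_X, if_neg (by omega), coeff_expand_mul]
    ring
  have h0 : coeff n evenBernoulliSeries = bernoulli (2 * n) := by
    rw [evenBernoulliSeries, coeff_mk]
  rw [h3, h1, coeff_powerSumSeriesOne_mul_powerSumSeriesTwo, h0, logExpQuotient_eq,
    powerSumSeriesOne_eq, coeff_C_mul_X_add_expand_sq (by omega),
    coeff_C_mul_X_add_expand_cube, coeff_C_mul_X_add_expand_cube] at h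
  linear_combination h

end evenPart

/-! ### The sums of the theorem as coefficients of products. -/

section sums

lemma mem_posTriples {n : ℕ} {t : ℕ × ℕ × ℕ} :
    t ∈ posTriples n ↔ 1 ≤ t.1 ∧ 1 ≤ t.2.1 ∧ 1 ≤ t.2.2 ∧ t.1 + t.2.1 + t.2.2 = n := by
  simp only [posTriples, Finset.mem_filter, Finset.mem_product, Finset.mem_Icc]
  omega

/-- Vanishing constant terms discard the triples with a zero entry. -/
lemma sum_posTriples_coeff {U V W : ℚ⟦X⟧} (hU : coeff 0 U = 0) (hV : coeff 0 V = 0)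
    (hW : coeff 0 W = 0) (n : ℕ) :
    ∑ t ∈ posTriples n, coeff t.1 U * coeff t.2.1 V * coeff t.2.2 W = coeff n (U * V * W) := by
  rw [mul_assoc, coeff_mul]
  simp only [coeff_mul, Finset.mul_sum]
  rw [Finset.sum_sigma']
  refine Finset.sum_bij_ne_zero (fun t _ _ => ⟨(t.1, t.2.1 + t.2.2), (t.2.1, t.2.2)⟩)
    ?_ ?_ ?_ ?_
  · intro t ht _
    have := mem_posTriples.1 ht
    simp only [Finset.mem_sigma, Finset.HasAntidiagonal.mem_antidiagonal, and_true]
    omega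
  · rintro ⟨a, b, c⟩ _ _ ⟨a', b', c'⟩ _ _ h
    simp only [Sigma.mk.injEq, Prod.mk.injEq, heq_eq_eq] at h
    simp [h.1.1, h.2.1, h.2.2]
  · rintro ⟨⟨a, d⟩, ⟨b, c⟩⟩ h hne
    simp only [Finset.mem_sigma, Finset.HasAntidiagonal.mem_antidiagonal] at h
    obtain ⟨h1, rfl⟩ := h
    simp only at hne
    have pos : ∀ {f : ℚ⟦X⟧} {i : ℕ}, coeff 0 f = 0 → coeff i f ≠ 0 → 1 ≤ i := by
      intro f i hf hi
      rcases Nat.eq_zero_or_pos i with rfl | h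
      · exact absurd hf hi
      · exact h
    refine ⟨(a, b, c), mem_posTriples.2 ⟨pos hU (left_ne_zero_of_mul hne),
      pos hV (left_ne_zero_of_mul (right_ne_zero_of_mul hne)),
      pos hW (right_ne_zero_of_mul (right_ne_zero_of_mul hne)), by simp only; omega⟩, ?_, rfl⟩
    simpa only [mul_assoc] using hne
  · intro t _ _
    simp only [mul_assoc]

lemma sum_Icc_coeff {U V : ℚ⟦X⟧} (hU : coeff 0 U = 0) (hV : coeff 0 V = 0) {n : ℕ}
    (hn : 1 ≤ n) :
    ∑ k ∈ Finset.Icc 1 (n - 1), coeff k U * coeff (n - k) V = coeff n (U * V) := by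
  rw [coeff_mul, Finset.Nat.sum_antidiagonal_eq_sum_range_succ_mk]
  refine Finset.sum_subset ?_ ?_
  · intro k hk
    rw [Finset.mem_Icc] at hk
    rw [Finset.mem_range]
    omega
  · intro k hk hk'
    rw [Finset.mem_range] at hk
    rw [Finset.mem_Icc] at hk'
    rcases Nat.eq_zero_or_pos k with rfl | h
    · rw [hU, zero_mul]
    · rw [show n - k = 0 by omega, hV, mul_zero]

lemma coeff_zero_evenLogSeries : coeff 0 evenLogSeries = 0 := by
  simp [evenLogSeries]

lemma coeff_zero_eulerOp (f : ℚ⟦X⟧) : coeff 0 (eulerOp f) = 0 := by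
  rw [coeff_eulerOp, Nat.cast_zero, zero_mul]

lemma sum_posTriples_bernoulli_div (n : ℕ) :
    ∑ t ∈ posTriples n,
        bernoulli (2 * t.1) * bernoulli (2 * t.2.1) * bernoulli (2 * t.2.2) /
          ((2 * (t.1 : ℚ)) * (2 * (t.2.1 : ℚ)) * (2 * (t.2.2 : ℚ))) =
      coeff n (evenPowerSumSeries ^ 3) := by
  have h0 : coeff 0 evenPowerSumSeries = 0 := by simp [evenPowerSumSeries]
  rw [show evenPowerSumSeries ^ 3 =
    evenPowerSumSeries * evenPowerSumSeries * evenPowerSumSeries by ring,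
    ← sum_posTriples_coeff h0 h0 h0]
  refine Finset.sum_congr rfl fun t _ => ?_
  simp only [evenPowerSumSeries, coeff_mk, div_mul_div_comm]

lemma sum_posTriples_bernoulli_mul_multinomial (n : ℕ) :
    ∑ t ∈ posTriples n,
        bernoulli (2 * t.1) * bernoulli (2 * t.2.1) * bernoulli (2 * t.2.2) /
          ((2 * (t.1 : ℚ)) * (2 * (t.2.1 : ℚ))) *
          (Nat.multinomial Finset.univ ![2 * t.1, 2 * t.2.1, 2 * t.2.2] : ℚ) =
      (2 * n).factorial * (2 * n / 3 * coeff n (evenLogSeries ^ 3)) := by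
  -- The factor without a denominator is a θ-derivative, and 3E²·θE = θ(E³). The analogous 2E·θE =
  -- θ(E²) serves the binomial sum.
  have h3 : 3 * coeff n (evenLogSeries * evenLogSeries * eulerOp evenLogSeries) =
      n * coeff n (evenLogSeries ^ 3) := by
    rw [← coeff_eulerOp, ← coeff_C_mul, map_ofNat]
    congr 1
    rw [pow_three, eulerOp_mul, eulerOp_mul]
    ring
  rw [show (2 * (n : ℚ) / 3 * coeff n (evenLogSeries ^ 3)) =
      2 * coeff n (evenLogSeries * evenLogSeries * eulerOp evenLogSeries) by
    linear_combination -(2 / 3 : ℚ) * h3,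
    ← sum_posTriples_coeff coeff_zero_evenLogSeries coeff_zero_evenLogSeries
    (coeff_zero_eulerOp _), Finset.mul_sum, Finset.mul_sum]
  refine Finset.sum_congr rfl fun t ht => ?_
  obtain ⟨ha, hb, hc, hs⟩ := mem_posTriples.1 ht
  have hm := Nat.multinomial_spec Finset.univ ![2 * t.1, 2 * t.2.1, 2 * t.2.2]
  simp only [Fin.prod_univ_three, Fin.sum_univ_three, Matrix.cons_val] at hm
  rw [show 2 * t.1 + 2 * t.2.1 + 2 * t.2.2 = 2 * n by omega] at hm
  rw [← hm, coeff_eulerOp]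
  simp only [evenLogSeries, coeff_mk]
  have ha' : (t.1 : ℚ) ≠ 0 := by positivity
  have hb' : (t.2.1 : ℚ) ≠ 0 := by positivity
  have hc' : (t.2.2 : ℚ) ≠ 0 := by positivity
  push_cast
  field_simp

lemma sum_choose_mul_bernoulli {n : ℕ} (hn : 1 ≤ n) :
    ∑ k ∈ Finset.Icc 1 (n - 1),
        ((2 * n).choose (2 * k) : ℚ) *
          (bernoulli (2 * k) * bernoulli (2 * n - 2 * k) / (2 * (k : ℚ))) =
      (2 * n).factorial * (n * coeff n (evenLogSeries ^ 2)) := by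
  have h2 : 2 * coeff n (evenLogSeries * eulerOp evenLogSeries) =
      n * coeff n (evenLogSeries ^ 2) := by
    rw [← coeff_eulerOp, ← coeff_C_mul, map_ofNat]
    congr 1
    rw [pow_two, eulerOp_mul]
    ring
  rw [← h2, ← sum_Icc_coeff coeff_zero_evenLogSeries (coeff_zero_eulerOp _) hn, Finset.mul_sum,
    Finset.mul_sum]
  refine Finset.sum_congr rfl fun k hk => ?_
  rw [Finset.mem_Icc] at hk
  obtain ⟨m, rfl⟩ : ∃ m, n = k + m := ⟨n - k, by omega⟩
  have hc := Nat.choose_mul_factorial_mul_factorial (n := 2 * (k + m)) (k := 2 * k) (by omega)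
  rw [show 2 * (k + m) - 2 * k = 2 * m by omega] at hc ⊢
  rw [← hc, coeff_eulerOp, Nat.add_sub_cancel_left]
  simp only [evenLogSeries, coeff_mk]
  have hk' : (k : ℚ) ≠ 0 := by have := hk.1; positivity
  have hm' : (m : ℚ) ≠ 0 := by
    have : 0 < m := by omega
    positivity
  push_cast
  field_simp

end sums

theorem theorem5p2 (n : ℕ) (hn : 3 ≤ n) :
    ∑ t ∈ posTriples n,
        bernoulli (2 * t.1) * bernoulli (2 * t.2.1) * bernoulli (2 * t.2.2) /
          ((2 * (t.1 : ℚ)) * (2 * (t.2.1 : ℚ)) * (2 * (t.2.2 : ℚ))) =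
      3 / (2 * (n : ℚ)) *
        (∑ t ∈ posTriples n,
          bernoulli (2 * t.1) * bernoulli (2 * t.2.1) * bernoulli (2 * t.2.2) /
            ((2 * (t.1 : ℚ)) * (2 * (t.2.1 : ℚ))) *
            (Nat.multinomial Finset.univ ![2 * t.1, 2 * t.2.1, 2 * t.2.2] : ℚ)) +
      3 / (n : ℚ) * harmonic (2 * n) *
        (∑ k ∈ Finset.Icc 1 (n - 1),
          ((2 * n).choose (2 * k) : ℚ) *
            (bernoulli (2 * k) * bernoulli (2 * n - 2 * k) / (2 * (k : ℚ)))) +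
      6 * harmonicTwo (2 * n) * (bernoulli (2 * n) / (2 * (n : ℚ))) -
      ((n : ℚ) ^ 2 - 3 / 2 * (n : ℚ) + 5 / 4) *
        (bernoulli (2 * n - 2) / (2 * (n : ℚ) - 2)) := by
  rw [sum_posTriples_bernoulli_div, sum_posTriples_bernoulli_mul_multinomial,
    sum_choose_mul_bernoulli (by omega)]
  obtain ⟨m, rfl⟩ : ∃ m, n = m + 1 := ⟨n - 1, by omega⟩
  have hm : (m : ℚ) ≠ 0 := by
    have : 0 < m := by omega
    positivity
  have key := factorial_mul_coeff_evenLogSeries (n := m) (by omega)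
  have top : ((2 * (m + 1)).factorial : ℚ) * coeff (m + 1) evenLogSeries =
      bernoulli (2 * (m + 1)) / (2 * ((m + 1 : ℕ) : ℚ)) := by
    rw [evenLogSeries, coeff_mk]
    field_simp
  have low : ((2 * (m + 1)).factorial : ℚ) * coeff m evenLogSeries =
      (2 * m + 2) * (2 * m + 1) * (bernoulli (2 * m) / (2 * m)) := by
    rw [evenLogSeries, coeff_mk, show 2 * (m + 1) = 2 * m + 1 + 1 by ring, Nat.factorial_succ,
      Nat.factorial_succ]
    push_cast
    field_simp
    ring
  have one : coeff m evenPowerSumSeries = bernoulli (2 * m) / (2 * m) := by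
    rw [evenPowerSumSeries, coeff_mk]
  have b : bernoulli (2 * m) = 2 * m * (bernoulli (2 * m) / (2 * m)) := by field_simp
  rw [one] at key
  rw [show 2 * (m + 1) - 2 = 2 * m by omega, ← top,
    show 2 * ((m + 1 : ℕ) : ℚ) - 2 = 2 * m by push_cast; ring]
  have hm1 : ((m + 1 : ℕ) : ℚ) ≠ 0 := by positivity
  rw [show ∀ H A B F : ℚ, 3 / (2 * ((m + 1 : ℕ) : ℚ)) * (F * (2 * ((m + 1 : ℕ) : ℚ) / 3 * A)) +
      3 / ((m + 1 : ℕ) : ℚ) * H * (F * (((m + 1 : ℕ) : ℚ) * B)) = F * A + 3 * H * F * B by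
    intros; field_simp]
  push_cast
  -- With n = m + 1, the factor of B_{2m}/(2m) is (3/4)(2m+2)(2m+1) - 2m(2m + 5/2) - 9/4 = -(n² -
  -- 3n/2 + 5/4).
  linear_combination 3 / 4 * low - key - (2 * m + 5 / 2 : ℚ) * b
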